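/- Let $\mathbb D\subset\mathbb C$ be the open unit disc, $B(p,r)$ the open disc of center $p$ and radius $r$, and $m$ the two-dimensional Lebesgue measure. Let $\psi:[0,2\pi)\to\mathbb C$ be an arbitrary Lebesgue measurable function, and let $S\subset[0,2\pi)$ be a (possibly empty) subset that is closed in $[0,2\pi)$ and such that the restriction $\psi|_S$ is continuous. Then there exists a function $f$, holomorphic in $\mathbb D$, such that for every $\theta\in S$ and for almost every $\theta\in[0,2\pi)$ there is a set $E_\theta\subset\mathbb D$, closed in $\mathbb D$ (in the relative topology), with $$f(z)\to\psi(\theta)\quad\text{as } z\to e^{i\theta},\ z\in E_\theta,$$ and $$\lim_{r\to0^+}\frac{m\big(B(e^{i\theta},r)\cap E_\theta\big)}{m\big(B(e^{i\theta},r)\cap\mathbb D\big)}=1.$$ -/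

import Mathlib

open Set Filter Topology MeasureTheory

/-- `E` is a subset of `U` which is closed in the subspace topology of `U`. -/
def IsClosedIn {X : Type*} [TopologicalSpace X] (E U : Set X) : Prop :=
  ∃ C : Set X, IsClosed C ∧ E = C ∩ U

/-- The open unit disc of the complex plane. -/
def unitDisc : Set ℂ := Metric.ball (0 : ℂ) 1

/-- `F` has area density `α` at the point `p`, relative to `U` (with respect to planar Lebesgue
measure): the ratio `m (B(p,r) ∩ F) / m (B(p,r) ∩ U)` tends to `α` as `r → 0+`. -/
def HasRelDensity (F U : Set ℂ) (p : ℂ) (α : ℝ) : Prop :=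
  Tendsto (fun r : ℝ => volume.real (Metric.ball p r ∩ F) / volume.real (Metric.ball p r ∩ U))
    (𝓝[>] 0) (𝓝 α)

/-- `f` tends to `w` at the point `p`, along some set that is closed in the unit disc and has
density `1` at `p` relative to the unit disc. -/
def HasDensityLimit (f : ℂ → ℂ) (p w : ℂ) : Prop :=
  ∃ E : Set ℂ, IsClosedIn E unitDisc ∧ Tendsto f (𝓝[E] p) (𝓝 w) ∧ HasRelDensity E unitDisc p 1

/-! The boundary data are first traded for a sequence of continuous functions. Lusin's theorem off
`S` and Tietze extension give `G n`, continuous on the plane, with `G n (exp (iθ)) = ψ θ` for all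
large `n`: for every `θ ∈ S`, by exhausting `S` by compact sets, and for almost every `θ`, by
Borel–Cantelli. It then suffices to find one holomorphic `f` whose density limit at `p` is `lim G n
p` wherever that limit exists (`exists_holomorphic_hasDensityLimit`).

Cut the disc into rings `1 - δ n ≤ ‖z‖ < 1 - δ (n + 1)`, so near the circle that `G n` varies little
at the scale of the cube root of `δ n`. Removing thin slits and margins from a ring leaves a compact
set `Q n` of almost full area whose union with the inner disc has connected complement. A polynomial
can therefore stay close to the previous one on the disc and be close to `G n` on `Q n`. The errors
are summable, so the polynomials converge to some `f`, and `f - G n` is small on `Q n`.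

At `p` take the part of `⋃ n, Q n` where `‖z - p‖ ^ 3 ≤ 1 - ‖z‖`. This cut loses only area `O(r ^
3)` in `B(p, r)`, yet on `Q n` it forces `z` so close to `p` that `G n z` is close to `G n p`. No
uniformity in `p` is needed.

The Runge-type step is algebraic. For such `K` every character of the closed polynomial algebra is
evaluation at a point of `K`, so zero-free elements are invertible in it. Hence `1 / (1 + g ^ M)`
and its limit, the indicator of `{‖g‖ < 1}`, lie in the algebra; such indicators glue the pieces
together. -/

/-- Every point outside `K` can escape to infinity along a connected set that avoids `K`; for
compact `K` this says that the complement of `K` is connected. -/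
def EscapesToInfinity (K : Set ℂ) : Prop :=
  ∀ a ∉ K, ∃ C : Set ℂ, IsPreconnected C ∧ a ∈ C ∧ Disjoint C K ∧ ¬ Bornology.IsBounded C

/-- The coordinate function on `K`. -/
def coordOn (K : Set ℂ) : C(K, ℂ) := ⟨Subtype.val, continuous_subtype_val⟩

/-- The uniform closure on `K` of the polynomials. -/
noncomputable abbrev polyAlg (K : Set ℂ) [CompactSpace K] : Subalgebra ℂ C(K, ℂ) :=
  Algebra.elemental ℂ (coordOn K)

/-- The coordinate function as an element of the uniform closure of the polynomials. -/
noncomputable def polyAlgCoord (K : Set ℂ) [CompactSpace K] : polyAlg K :=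
  ⟨coordOn K, Algebra.elemental.self_mem ℂ _⟩

/-! ### Uniform limits of polynomials on compact sets with connected complement -/

section Runge

variable {K : Set ℂ} [CompactSpace K]

/-- In a closed subalgebra the frontier of the spectrum stays inside the spectrum for the full
algebra, here the range `K` of the coordinate. A connected unbounded set avoiding `K` cannot start
in the bounded spectrum, since it would have to cross that frontier. -/
theorem spectrum_polyAlgCoord_subset [Nonempty K] (hK : EscapesToInfinity K) :
    spectrum ℂ (polyAlgCoord K) ⊆ K := by
  intro a ha
  by_contra haK
  obtain ⟨C, hC, haC, hdisj, hunb⟩ := hK a haK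
  have hfr : frontier (spectrum ℂ (polyAlgCoord K)) ⊆ K := by
    refine (Subalgebra.frontier_spectrum (polyAlg K) (polyAlgCoord K)).trans ?_
    rw [ContinuousMap.spectrum_eq_range]
    rintro _ ⟨x, rfl⟩
    exact x.2
  have hout : (C ∩ (spectrum ℂ (polyAlgCoord K))ᶜ).Nonempty := by
    by_contra h
    refine hunb ((spectrum.isBounded (𝕜 := ℂ) (polyAlgCoord K)).subset fun z hz => ?_)
    by_contra hz'
    exact h ⟨z, hz, hz'⟩
  have hmeet : (C ∩ frontier (spectrum ℂ (polyAlgCoord K))).Nonempty := by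
    by_contra h
    rw [Set.not_nonempty_iff_eq_empty] at h
    have hcl : IsClosed (spectrum ℂ (polyAlgCoord K)) := spectrum.isClosed _
    obtain ⟨z, hz, hz'⟩ := hout
    obtain ⟨y, hy, hy1, hy2⟩ := hC (interior (spectrum ℂ (polyAlgCoord K)))
      (spectrum ℂ (polyAlgCoord K))ᶜ isOpen_interior hcl.isOpen_compl (by
        intro y hy
        by_cases hys : y ∈ spectrum ℂ (polyAlgCoord K)
        · left
          by_contra hyi
          have : y ∈ C ∩ frontier (spectrum ℂ (polyAlgCoord K)) :=
            ⟨hy, by rw [hcl.frontier_eq]; exact ⟨hys, hyi⟩⟩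
          rw [h] at this
          exact this
        · exact Or.inr hys)
      ⟨a, haC, by
        by_contra hyi
        have : a ∈ C ∩ frontier (spectrum ℂ (polyAlgCoord K)) :=
          ⟨haC, by rw [hcl.frontier_eq]; exact ⟨ha, hyi⟩⟩
        rw [h] at this
        exact this⟩ ⟨z, hz, hz'⟩
    exact hy2 (interior_subset hy1)
  obtain ⟨y, hy, hy'⟩ := hmeet
  exact Set.disjoint_left.1 hdisj hy (hfr hy')

/-- A character is continuous and polynomials are dense, so it is determined by its value at the
coordinate, a spectral value and hence a point of `K`. -/
theorem character_polyAlg_eq_eval [Nonempty K] (hK : EscapesToInfinity K)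
    (φ : WeakDual.characterSpace ℂ (polyAlg K)) :
    ∃ k : K, ∀ g : polyAlg K, φ g = (g : C(K, ℂ)) k := by
  have hmem : φ (polyAlgCoord K) ∈ spectrum ℂ (polyAlgCoord K) :=
    AlgHom.apply_mem_spectrum (WeakDual.CharacterSpace.toAlgHom φ) _
  refine ⟨⟨_, spectrum_polyAlgCoord_subset hK hmem⟩, ?_⟩
  set k : K := ⟨_, spectrum_polyAlgCoord_subset hK hmem⟩ with hk
  have hφ : Continuous φ := map_continuous φ
  have hev : Continuous fun g : polyAlg K => (g : C(K, ℂ)) k :=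
    (continuous_eval_const k).comp continuous_subtype_val
  rintro ⟨g, hg⟩
  have hpoly : ∀ p : Polynomial ℂ, φ (Polynomial.aeval (polyAlgCoord K) p) =
      ((Polynomial.aeval (polyAlgCoord K) p : polyAlg K) : C(K, ℂ)) k := by
    intro p
    induction p using Polynomial.induction_on' with
    | add p q hp hq => simp [map_add, hp, hq]
    | monomial n c =>
      have h1 : (polyAlgCoord K : C(K, ℂ)) k = φ (polyAlgCoord K) := rfl
      have h2 : φ (algebraMap ℂ (polyAlg K) c) = c :=
        AlgHom.commutes (WeakDual.CharacterSpace.toAlgHom φ) c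
      simp [Polynomial.aeval_monomial, map_mul, map_pow, h1, h2]
  have hcl : IsClosed {g : polyAlg K | φ g = (g : C(K, ℂ)) k} := isClosed_eq hφ hev
  have hdense : (⟨g, hg⟩ : polyAlg K) ∈
      closure (Set.range fun p : Polynomial ℂ => Polynomial.aeval (polyAlgCoord K) p) := by
    rw [closure_subtype]
    refine closure_mono ?_ hg
    intro x hx
    have hx' : x ∈ Algebra.adjoin ℂ {coordOn K} := hx
    rw [Algebra.adjoin_singleton_eq_range_aeval] at hx'
    obtain ⟨p, rfl⟩ := hx'
    refine ⟨_, ⟨p, rfl⟩, ?_⟩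
    have := Polynomial.aeval_algHom_apply (polyAlg K).val (polyAlgCoord K) p
    exact this.symm
  have hsub : closure (Set.range fun p : Polynomial ℂ => Polynomial.aeval (polyAlgCoord K) p) ⊆
      {g : polyAlg K | φ g = (g : C(K, ℂ)) k} :=
    closure_minimal (by rintro _ ⟨p, rfl⟩; exact hpoly p) hcl
  exact hsub hdense

/-- Gelfand theory: a non-unit is annihilated by some character, that is, vanishes at a point of
`K`. -/
theorem exists_inverse_mem_polyAlg [Nonempty K] (hK : EscapesToInfinity K) {g : C(K, ℂ)}
    (hg : g ∈ polyAlg K) (h0 : ∀ x, g x ≠ 0) : ∃ h ∈ polyAlg K, ∀ x, h x = (g x)⁻¹ := by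
  have hunit : IsUnit (⟨g, hg⟩ : polyAlg K) := by
    by_contra hn
    obtain ⟨φ, hφ⟩ := WeakDual.CharacterSpace.exists_apply_eq_zero hn
    obtain ⟨k, hk⟩ := character_polyAlg_eq_eval hK φ
    exact h0 k ((hk _).symm.trans hφ)
  obtain ⟨⟨h, hh⟩, hmul⟩ := hunit.exists_right_inv
  refine ⟨h, hh, fun x => ?_⟩
  have : g * h = 1 := congrArg Subtype.val hmul
  have hx : g x * h x = 1 := by simpa using congrArg (fun u : C(K, ℂ) => u x) this
  exact eq_inv_of_mul_eq_one_right hx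

/-- If `g` is a uniform limit of polynomials on `K` and `‖g‖` omits the value `1`, the indicator
function of `{‖g‖ < 1}` is a uniform limit of polynomials, namely the limit of `1 / (1 + g ^ M)`. -/
theorem exists_indicator_mem_polyAlg [Nonempty K] (hK : EscapesToInfinity K) {g : C(K, ℂ)}
    (hg : g ∈ polyAlg K) (h1 : ∀ x, ‖g x‖ ≠ 1) :
    ∃ e ∈ polyAlg K, (∀ x, ‖g x‖ < 1 → e x = 1) ∧ ∀ x, 1 < ‖g x‖ → e x = 0 := by
  classical
  have hclopen : IsClopen {x | ‖g x‖ < 1} := by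
    refine ⟨?_, isOpen_lt g.continuous.norm continuous_const⟩
    have : {x | ‖g x‖ < 1} = {x | ‖g x‖ ≤ 1} := by
      ext x
      simp only [mem_ofPred_eq]
      exact ⟨fun h => h.le, fun h => lt_of_le_of_ne h (h1 x)⟩
    rw [this]
    exact isClosed_le g.continuous.norm continuous_const
  let e : C(K, ℂ) := ⟨fun x => if ‖g x‖ < 1 then 1 else 0,
    continuous_if (fun a ha => by
      have := hclopen.frontier_eq
      rw [this] at ha
      exact absurd ha (Set.notMem_empty a)) continuous_const.continuousOn
      continuous_const.continuousOn⟩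
  have hne : ∀ M : ℕ, ∀ x, (1 + g ^ (M + 1) : C(K, ℂ)) x ≠ 0 := by
    intro M x hx
    have : g x ^ (M + 1) = -1 := by
      have h : 1 + g x ^ (M + 1) = 0 := by simpa using hx
      linear_combination h
    have hn : ‖g x‖ ^ (M + 1) = 1 := by rw [← norm_pow, this]; simp
    exact h1 x ((pow_eq_one_iff_of_nonneg (norm_nonneg _) (Nat.succ_ne_zero M)).1 hn)
  have hmem : ∀ M : ℕ, (1 + g ^ (M + 1) : C(K, ℂ)) ∈ polyAlg K := fun M =>
    add_mem (one_mem _) (pow_mem hg _)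
  choose u hu huv using fun M => exists_inverse_mem_polyAlg hK (hmem M) (hne M)
  -- `q < 1` bounds both `‖g‖` below `1` and `1/‖g‖` above `1`
  obtain ⟨q, hq0, hq1, hq⟩ : ∃ q : ℝ, 0 ≤ q ∧ q < 1 ∧ ∀ x, ‖g x‖ ≤ q ∨ 1 ≤ q * ‖g x‖ := by
    -- `q` is the maximum over `K` of `min ‖g‖ (1/‖g‖)`; the `max 1` keeps the quotient continuous
    -- at zeros of `g`.
    obtain ⟨x₀, hx₀⟩ := (isCompact_univ : IsCompact (univ : Set K)).exists_isMaxOn univ_nonempty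
      (f := fun x => min ‖g x‖ (1 / max 1 ‖g x‖)) (by
        refine Continuous.continuousOn ?_
        refine g.continuous.norm.min (continuous_const.div (continuous_const.max g.continuous.norm)
          fun x => ?_)
        positivity)
    refine ⟨min ‖g x₀‖ (1 / max 1 ‖g x₀‖), by positivity, ?_, fun x => ?_⟩
    · rcases lt_or_gt_of_ne (h1 x₀) with h | h
      · exact min_lt_of_left_lt h
      · refine min_lt_of_right_lt ?_
        rw [max_eq_right h.le, div_lt_one (by linarith)]
        exact h
    · have hm := hx₀.2 (mem_univ x)
      simp only [mem_ofPred_eq] at hm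
      rcases lt_or_gt_of_ne (h1 x) with h | h
      · left
        rw [max_eq_left h.le, div_one, min_eq_left h.le] at hm
        exact hm
      · right
        have : 1 / ‖g x‖ ≤ min ‖g x₀‖ (1 / max 1 ‖g x₀‖) := by
          rw [max_eq_right h.le, min_eq_right] at hm
          · exact hm
          · rw [div_le_iff₀ (by linarith)]; nlinarith
        rwa [div_le_iff₀ (by linarith)] at this
  have hlim : Tendsto (fun M : ℕ => q ^ (M + 1) / (1 - q ^ (M + 1))) atTop (𝓝 0) := by
    have h := (tendsto_pow_atTop_nhds_zero_of_lt_one hq0 hq1).comp (tendsto_add_atTop_nat 1)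
    have := h.div (tendsto_const_nhds (x := (1 : ℝ)) |>.sub h) (by simp)
    rw [zero_div] at this
    exact this
  have hbd : ∀ M x, dist (u M x) (e x) ≤ q ^ (M + 1) / (1 - q ^ (M + 1)) := by
    intro M x
    have hqM : q ^ (M + 1) < 1 := pow_lt_one₀ hq0 hq1 (Nat.succ_ne_zero M)
    rw [huv M x, dist_eq_norm]
    change ‖(1 + g x ^ (M + 1))⁻¹ - (if ‖g x‖ < 1 then (1 : ℂ) else 0)‖ ≤ _
    have hnz : 1 + g x ^ (M + 1) ≠ 0 := by simpa using hne M x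
    rcases hq x with h | h
    · rw [if_pos (h.trans_lt hq1)]
      have hp : ‖g x ^ (M + 1)‖ ≤ q ^ (M + 1) := by
        rw [norm_pow]; exact pow_le_pow_left₀ (norm_nonneg _) h _
      have : (1 + g x ^ (M + 1))⁻¹ - 1 = - (g x ^ (M + 1)) / (1 + g x ^ (M + 1)) := by
        field_simp; ring
      rw [this, norm_div, norm_neg]
      have h2 : 1 - q ^ (M + 1) ≤ ‖1 + g x ^ (M + 1)‖ := by
        have := norm_sub_le_norm_add (1 : ℂ) (g x ^ (M + 1))
        rw [norm_one] at this
        linarith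
      exact div_le_div₀ (by positivity) hp (by linarith) h2
    · have hg1 : 1 < ‖g x‖ := by
        by_contra hcon
        have := not_lt.1 hcon
        nlinarith [norm_nonneg (g x)]
      rw [if_neg (not_lt.2 hg1.le), sub_zero, norm_inv]
      set t := ‖g x‖ ^ (M + 1) with ht
      have ht1 : 1 ≤ q ^ (M + 1) * t := by
        rw [ht, ← mul_pow]; exact one_le_pow₀ h
      have h2 : t - 1 ≤ ‖1 + g x ^ (M + 1)‖ := by
        have := norm_sub_le_norm_add (g x ^ (M + 1)) (1 : ℂ)
        rw [norm_one, norm_pow, add_comm (g x ^ (M + 1))] at this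
        exact this
      have ht1' : 1 < t := one_lt_pow₀ hg1 (Nat.succ_ne_zero M)
      have hqp : 0 < 1 - q ^ (M + 1) := by linarith
      have h3 : 0 < ‖1 + g x ^ (M + 1)‖ := norm_pos_iff.2 hnz
      rw [inv_le_comm₀ h3 (by apply div_pos _ hqp; nlinarith [pow_nonneg hq0 (M+1)]), inv_div]
      refine le_trans ?_ h2
      have hqpos : 0 < q ^ (M + 1) := by nlinarith [pow_nonneg hq0 (M+1)]
      rw [div_le_iff₀ hqpos]
      nlinarith
  refine ⟨e, ?_, fun x hx => if_pos hx, fun x hx => if_neg (not_lt.2 hx.le)⟩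
  have hcl : IsClosed (polyAlg K : Set C(K, ℂ)) := Algebra.elemental.isClosed ℂ _
  refine hcl.mem_of_tendsto (f := u) (b := atTop) ?_ (Eventually.of_forall hu)
  rw [tendsto_iff_dist_tendsto_zero]
  refine squeeze_zero (fun _ => dist_nonneg) (fun M => ?_) hlim
  rw [ContinuousMap.dist_le]
  · exact hbd M
  · have hqM : q ^ (M + 1) < 1 := pow_lt_one₀ hq0 hq1 (Nat.succ_ne_zero M)
    exact div_nonneg (by positivity) (by linarith)

theorem polynomial_mem_polyAlg (p : Polynomial ℂ) : p.toContinuousMapOn K ∈ polyAlg K := by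
  have : p.toContinuousMapOn K = Polynomial.aeval (coordOn K) p := by
    ext x
    rw [Polynomial.aeval_continuousMap_apply]
    simp [coordOn]
  rw [this]
  exact Subalgebra.le_topologicalClosure _
    ((Algebra.adjoin_singleton_eq_range_aeval ℂ (coordOn K)).symm ▸ ⟨p, rfl⟩)

theorem exists_polynomial_near {g : C(K, ℂ)} (hg : g ∈ polyAlg K) {ε : ℝ} (hε : 0 < ε) :
    ∃ p : Polynomial ℂ, ∀ x : K, dist (p.eval (x : ℂ)) (g x) ≤ ε := by
  have hg' : g ∈ closure (Algebra.adjoin ℂ {coordOn K} : Set C(K, ℂ)) := hg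
  obtain ⟨h, hh, hd⟩ := Metric.mem_closure_iff.1 hg' ε hε
  rw [SetLike.mem_coe, Algebra.adjoin_singleton_eq_range_aeval] at hh
  obtain ⟨p, rfl⟩ := hh
  refine ⟨p, fun x => ?_⟩
  have h1 := (ContinuousMap.dist_apply_le_dist (f := g)
    (g := (Polynomial.aeval (coordOn K) p : C(K, ℂ))) x).trans hd.le
  rw [dist_comm]
  rwa [Polynomial.aeval_continuousMap_apply] at h1

/-- Any function of finitely many `0`-`1` valued elements of the algebra is in the algebra. -/
theorem exists_mem_polyAlg_of_idempotents {n : ℕ} {e : Fin n → C(K, ℂ)}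
    (he : ∀ j, e j ∈ polyAlg K) (σ : K → Fin n → Bool)
    (hσ : ∀ x j, e j x = if σ x j then 1 else 0) (Φ : (Fin n → Bool) → ℂ) :
    ∃ g ∈ polyAlg K, ∀ x, g x = Φ (σ x) := by
  classical
  refine ⟨∑ v : Fin n → Bool, Φ v • ∏ j, if v j then e j else 1 - e j, ?_, fun x => ?_⟩
  · refine sum_mem fun v _ => Subalgebra.smul_mem (polyAlg K) (prod_mem fun j _ => ?_) _
    split_ifs
    · exact he j
    · exact sub_mem (one_mem _) (he j)
  · rw [ContinuousMap.coe_sum, Finset.sum_apply, Finset.sum_eq_single (σ x)]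
    · have : ∏ j, (if σ x j then e j else 1 - e j) x = 1 :=
        Finset.prod_eq_one fun j _ => by
          by_cases h : σ x j <;> simp [h, hσ]
      simp [ContinuousMap.coe_prod, this]
    · intro v _ hv
      obtain ⟨j, hj⟩ := Function.ne_iff.1 hv
      have : (∏ j, (if v j then e j else 1 - e j) x) = 0 := by
        refine Finset.prod_eq_zero (Finset.mem_univ j) ?_
        by_cases h : v j <;> by_cases h' : σ x j <;> simp_all
      simp [ContinuousMap.coe_prod, this]
    · simp

end Runge

/-! ### Sectors and slit rings -/

/-- The oriented distance from `z` to the line through `0` in the direction `-π + 2πj/M`. -/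
noncomputable def raySep (M j : ℕ) (z : ℂ) : ℝ :=
  (z * Complex.exp (-(((-Real.pi + j * (2 * Real.pi / M) : ℝ) : ℂ) * Complex.I))).im

theorem raySep_eq (M j : ℕ) (z : ℂ) :
    raySep M j z = ‖z‖ * Real.sin (z.arg + Real.pi - j * (2 * Real.pi / M)) := by
  have h : z * Complex.exp (-(((-Real.pi + j * (2 * Real.pi / M) : ℝ) : ℂ) * Complex.I)) =
      (‖z‖ : ℂ) * Complex.exp (((z.arg + Real.pi - j * (2 * Real.pi / M) : ℝ) : ℂ) *
        Complex.I) := by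
    conv_lhs => rw [← Complex.norm_mul_exp_arg_mul_I z]
    rw [mul_assoc, ← Complex.exp_add]
    congr 2
    push_cast
    ring
  rw [raySep, h, Complex.im_ofReal_mul, Complex.exp_ofReal_mul_I_im]

theorem continuous_raySep (M j : ℕ) : Continuous (raySep M j) := by
  unfold raySep
  fun_prop

theorem raySep_real_mul (M j : ℕ) (t : ℝ) (z : ℂ) : raySep M j (t * z) = t * raySep M j z := by
  rw [raySep, mul_assoc, Complex.im_ofReal_mul, raySep]

theorem norm_exp_mul_I_sub_le (x y : ℝ) :
    ‖Complex.exp (x * Complex.I) - Complex.exp (y * Complex.I)‖ ≤ |x - y| := by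
  have h : Complex.exp (x * Complex.I) - Complex.exp (y * Complex.I) =
      Complex.exp (y * Complex.I) * (Complex.exp (Complex.I * ((x - y : ℝ) : ℂ)) - 1) := by
    rw [mul_sub, ← Complex.exp_add, mul_one]
    congr 2
    push_cast
    ring
  rw [h, norm_mul, Complex.norm_exp_ofReal_mul_I, one_mul]
  exact (Real.norm_exp_I_mul_ofReal_sub_one_le).trans (Real.norm_eq_abs _).le

/-- Two points that no line `raySep M j = 0` separates lie in a common sector of angle `2π/M`. -/
theorem dist_le_of_raySep_pos_iff {M : ℕ} (hM : 2 ≤ M) {z w : ℂ}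
    (hz : ∀ j ≤ M, raySep M j z ≠ 0) (hzw : ∀ j ≤ M, 0 < raySep M j z ↔ 0 < raySep M j w) :
    dist z w ≤ |‖z‖ - ‖w‖| + ‖w‖ * (2 * Real.pi / M) := by
  have hπ := Real.pi_pos
  have hM' : (2 : ℝ) ≤ M := by exact_mod_cast hM
  set h : ℝ := 2 * Real.pi / M with hh
  have hpos : 0 < h := by positivity
  have hMh : M * h = 2 * Real.pi := by rw [hh]; field_simp
  have hle : h ≤ Real.pi := by nlinarith
  have hz0 : 0 < ‖z‖ := by
    rcases (norm_nonneg z).eq_or_lt with h0 | h0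
    · exact absurd (by rw [raySep_eq, ← h0, zero_mul]) (hz 0 (Nat.zero_le _))
    · exact h0
  set α := z.arg + Real.pi with hα
  set β := w.arg + Real.pi with hβ
  have hα0 : 0 < α := by linarith [Complex.neg_pi_lt_arg z]
  have hα1 : α ≤ 2 * Real.pi := by linarith [Complex.arg_le_pi z]
  have hβ0 : 0 < β := by linarith [Complex.neg_pi_lt_arg w]
  have hβ1 : β ≤ 2 * Real.pi := by linarith [Complex.arg_le_pi w]
  obtain ⟨j, hj⟩ : ∃ j : ℕ, j = ⌊α / h⌋₊ := ⟨_, rfl⟩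
  have hj0 : j * h ≤ α := by
    rw [← le_div_iff₀ hpos, hj]; exact Nat.floor_le (by positivity)
  have hj1 : α < (j + 1) * h := by
    rw [← div_lt_iff₀ hpos, hj]; exact Nat.lt_floor_add_one _
  -- The only other possibility is `α = 2π`, where `z` lies on the line of index `M`.
  have hjM : j < M := by
    by_contra hcon
    have hcon' : (M : ℝ) ≤ j := by exact_mod_cast not_lt.1 hcon
    have : α = 2 * Real.pi := by nlinarith
    refine hz M le_rfl ?_
    rw [raySep_eq, ← hα, ← hh, hMh, this, sub_self, Real.sin_zero, mul_zero]
  set θ := j * h with hθ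
  have e1 : ∀ u, raySep M j u = ‖u‖ * Real.sin (u.arg + Real.pi - θ) := fun u => raySep_eq M j u
  have e2 : ∀ u, raySep M (j + 1) u = ‖u‖ * Real.sin (u.arg + Real.pi - θ - h) := fun u => by
    rw [raySep_eq, ← hh, hθ]; push_cast; congr 2; ring
  have s1 : 0 < raySep M j z := by
    refine lt_of_le_of_ne ?_ (hz j hjM.le).symm
    rw [e1]
    exact mul_nonneg hz0.le (Real.sin_nonneg_of_nonneg_of_le_pi (by linarith) (by linarith))
  have s2 : ¬ 0 < raySep M (j + 1) z := by
    rw [e2, not_lt]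
    exact mul_nonpos_of_nonneg_of_nonpos hz0.le
      (Real.sin_nonpos_of_nonpos_of_neg_pi_le (by linarith) (by linarith))
  rw [hzw j hjM.le, e1, ← hβ] at s1
  rw [hzw (j + 1) hjM, e2, ← hβ] at s2
  have hw0 : 0 < ‖w‖ := by
    rcases (norm_nonneg w).eq_or_lt with h0 | h0
    · rw [← h0, zero_mul] at s1; exact absurd s1 (lt_irrefl _)
    · exact h0
  have t1 : 0 < Real.sin (β - θ) := pos_of_mul_pos_right s1 hw0.le
  have t2 : Real.sin (β - θ - h) ≤ 0 := by
    by_contra hcon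
    exact s2 (mul_pos hw0 (not_le.1 hcon))
  have hθM : θ + h ≤ 2 * Real.pi := by
    have : ((j : ℝ) + 1) ≤ M := by exact_mod_cast hjM
    nlinarith
  have hθ0 : 0 ≤ θ := by positivity
  -- The two signs locate the direction of `w` in the same sector only modulo `2π`, so `β - θ` may
  -- need a full turn added.
  obtain ⟨x, hx0, hx1, hxe⟩ : ∃ x : ℝ, 0 ≤ x ∧ x ≤ h ∧
      Complex.exp (w.arg * Complex.I) = Complex.exp (((x + θ - Real.pi : ℝ) : ℂ) * Complex.I) := by
    rcases le_or_gt (β - θ) 0 with hc | hc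
    · rcases le_or_gt (-Real.pi) (β - θ) with hc' | hc'
      · exact absurd (Real.sin_nonpos_of_nonpos_of_neg_pi_le hc hc') (not_le.2 t1)
      · refine ⟨β - θ + 2 * Real.pi, by linarith, ?_, ?_⟩
        · by_contra hcon
          have := Real.sin_pos_of_pos_of_lt_pi (x := β - θ - h + 2 * Real.pi) (by linarith)
            (by linarith)
          rw [Real.sin_add_two_pi] at this
          linarith
        · rw [Complex.exp_eq_exp_iff_exists_int]
          refine ⟨-1, ?_⟩
          rw [hβ]; push_cast; ring
    · rcases le_or_gt (β - θ) Real.pi with hc' | hc'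
      · refine ⟨β - θ, hc.le, ?_, ?_⟩
        · by_contra hcon
          have := Real.sin_pos_of_pos_of_lt_pi (x := β - θ - h) (by linarith) (by linarith)
          linarith
        · congr 2
          rw [hβ]; push_cast; ring
      · have : Real.sin (β - θ - 2 * Real.pi) ≤ 0 :=
          Real.sin_nonpos_of_nonpos_of_neg_pi_le (by linarith) (by linarith)
        rw [Real.sin_sub_two_pi] at this
        linarith
  have hkey : ‖Complex.exp (z.arg * Complex.I) - Complex.exp (w.arg * Complex.I)‖ ≤ h := by
    rw [hxe]
    refine (norm_exp_mul_I_sub_le _ _).trans ?_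
    rw [abs_le]
    constructor <;> linarith
  have hdec : z - w = ((‖z‖ - ‖w‖ : ℝ) : ℂ) * Complex.exp (z.arg * Complex.I) +
      (‖w‖ : ℂ) * (Complex.exp (z.arg * Complex.I) - Complex.exp (w.arg * Complex.I)) := by
    conv_lhs => rw [← Complex.norm_mul_exp_arg_mul_I z, ← Complex.norm_mul_exp_arg_mul_I w]
    push_cast
    ring
  rw [dist_eq_norm, hdec]
  refine (norm_add_le _ _).trans (add_le_add ?_ ?_)
  · rw [norm_mul, Complex.norm_exp_ofReal_mul_I, mul_one, Complex.norm_real, Real.norm_eq_abs]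
  · rw [norm_mul, Complex.norm_real, norm_norm]
    exact mul_le_mul_of_nonneg_left hkey (norm_nonneg _)

/-- The ring `a + τ ≤ ‖z‖ ≤ b - τ`, slit along the lines `raySep M j = 0`. -/
def slitRing (M : ℕ) (a b τ : ℝ) : Set ℂ :=
  {z | a + τ ≤ ‖z‖ ∧ ‖z‖ ≤ b - τ ∧ ∀ j ≤ M, τ * ‖z‖ ≤ |raySep M j z|}

theorem isCompact_slitRing (M : ℕ) (a b τ : ℝ) : IsCompact (slitRing M a b τ) := by
  refine (isCompact_closedBall (0 : ℂ) (b - τ)).of_isClosed_subset ?_ fun z hz => ?_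
  · have h : IsClosed {z : ℂ | ∀ j ≤ M, τ * ‖z‖ ≤ |raySep M j z|} := by
      have : {z : ℂ | ∀ j ≤ M, τ * ‖z‖ ≤ |raySep M j z|} =
          ⋂ j, ⋂ (_ : j ≤ M), {z : ℂ | τ * ‖z‖ ≤ |raySep M j z|} := by ext; simp
      rw [this]
      exact isClosed_iInter fun j => isClosed_iInter fun _ =>
        isClosed_le (continuous_const.mul continuous_norm) (continuous_raySep M j).abs
    exact (isClosed_le continuous_const continuous_norm).inter
      ((isClosed_le continuous_norm continuous_const).inter h)
  · rw [mem_closedBall_zero_iff]; exact hz.2.1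

theorem volume_raySep_eq_zero (M j : ℕ) : volume {z : ℂ | raySep M j z = 0} = 0 := by
  let e : ℂ := Complex.exp (-(((-Real.pi + j * (2 * Real.pi / M) : ℝ) : ℂ) * Complex.I))
  let L : ℂ →ₗ[ℝ] ℝ := Complex.imLm.comp (LinearMap.mulRight ℝ e)
  have hL : {z : ℂ | raySep M j z = 0} = (LinearMap.ker L : Set ℂ) := by
    ext z
    simp [L, raySep, e]
  rw [hL]
  refine Measure.addHaar_submodule _ _ fun htop => ?_
  have : Complex.I * e⁻¹ ∈ LinearMap.ker L := by rw [htop]; trivial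
  have he : e ≠ 0 := Complex.exp_ne_zero _
  simp [L, he] at this

/-- As `τ` decreases to `0`, the uncovered sets decrease to a subset of the circle `‖z‖ = a` and
countably many lines, a null set. -/
theorem exists_volume_diff_slitRing_le (M : ℕ) {a b : ℝ} (ha : 0 < a) {v : ENNReal}
    (hv : 0 < v) :
    ∃ τ : ℝ, 0 < τ ∧ volume ({z : ℂ | a ≤ ‖z‖ ∧ ‖z‖ < b} \ slitRing M a b τ) ≤ v := by
  set R : Set ℂ := {z : ℂ | a ≤ ‖z‖ ∧ ‖z‖ < b} with hR
  have hRm : MeasurableSet R := (measurableSet_le measurable_const measurable_norm).inter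
    (measurableSet_lt measurable_norm measurable_const)
  let s : ℕ → Set ℂ := fun k => R \ slitRing M a b (1 / ((k : ℝ) + 1))
  have hsm : ∀ k, NullMeasurableSet (s k) volume := fun k =>
    (hRm.diff (isCompact_slitRing M a b _).isClosed.measurableSet).nullMeasurableSet
  have hanti : Antitone s := by
    intro k l hkl
    refine sdiff_subset_sdiff_right fun z hz => ?_
    have h : 1 / ((l : ℝ) + 1) ≤ 1 / ((k : ℝ) + 1) := one_div_le_one_div_of_le (by positivity)
      (by have : (k : ℝ) ≤ l := by exact_mod_cast hkl
          linarith)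
    exact ⟨by linarith [hz.1], by linarith [hz.2.1], fun j hj =>
      (mul_le_mul_of_nonneg_right h (norm_nonneg z)).trans (hz.2.2 j hj)⟩
  have hfin : volume (s 0) ≠ ⊤ := by
    refine ((measure_mono ?_).trans_lt (measure_ball_lt_top (x := (0 : ℂ)) (r := b))).ne
    intro z hz
    rw [mem_ball_zero_iff]
    exact hz.1.2
  have hlim := tendsto_measure_iInter_atTop hsm hanti ⟨0, hfin⟩
  have hτ : Tendsto (fun k : ℕ => 1 / ((k : ℝ) + 1)) atTop (𝓝 0) :=
    tendsto_one_div_add_atTop_nhds_zero_nat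
  have hnull : volume (⋂ k, s k) = 0 := by
    refine measure_mono_null (t := Metric.sphere (0 : ℂ) a ∪
      ⋃ j, {z : ℂ | raySep M j z = 0}) ?_ (measure_union_null ?_
        (measure_iUnion_null fun j => volume_raySep_eq_zero M j))
    · intro z hz
      rw [mem_iInter] at hz
      by_contra hcon
      simp only [mem_union, mem_iUnion, not_or, not_exists, mem_ofPred_eq,
        mem_sphere_zero_iff_norm] at hcon
      have hza : a < ‖z‖ := lt_of_le_of_ne (hz 0).1.1 (Ne.symm hcon.1)
      have hzb : ‖z‖ < b := (hz 0).1.2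
      have h1 : ∀ᶠ k : ℕ in atTop, 1 / ((k : ℝ) + 1) < ‖z‖ - a :=
        hτ.eventually (gt_mem_nhds (by linarith))
      have h2 : ∀ᶠ k : ℕ in atTop, 1 / ((k : ℝ) + 1) < b - ‖z‖ :=
        hτ.eventually (gt_mem_nhds (by linarith))
      have h3 : ∀ᶠ k : ℕ in atTop, ∀ j ∈ Finset.range (M + 1),
          1 / ((k : ℝ) + 1) * ‖z‖ < |raySep M j z| := by
        rw [Filter.eventually_all_finset]
        intro j _
        have : Tendsto (fun k : ℕ => 1 / ((k : ℝ) + 1) * ‖z‖) atTop (𝓝 (0 * ‖z‖)) :=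
          hτ.mul_const _
        rw [zero_mul] at this
        exact this.eventually (gt_mem_nhds (abs_pos.2 (hcon.2 j)))
      obtain ⟨k, hk1, hk2, hk3⟩ := (h1.and (h2.and h3)).exists
      exact (hz k).2 ⟨by linarith, by linarith, fun j hj =>
        (hk3 j (Finset.mem_range.2 (by omega))).le⟩
    · exact Measure.addHaar_sphere_of_ne_zero _ _ ha.ne'
  rw [hnull] at hlim
  obtain ⟨k, hk⟩ := (hlim.eventually (gt_mem_nhds hv)).exists
  exact ⟨1 / ((k : ℝ) + 1), by positivity, hk.le⟩

/-- A point in a slit or beyond radius `b` escapes along its own ray, because the slit condition is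
homogeneous. A point in a round gap first follows its circle to the negative real axis, which is the
slit of index `0`. -/
theorem escapesToInfinity_closedBall_union_slitRing (M : ℕ) {a b τ : ℝ} (ha : 0 < a)
    (hτ : 0 < τ) : EscapesToInfinity (Metric.closedBall 0 a ∪ slitRing M a b τ) := by
  have hray : ∀ z : ℂ, a < ‖z‖ → (b < ‖z‖ ∨ ∃ j ≤ M, |raySep M j z| < τ * ‖z‖) →
      ∃ C : Set ℂ, IsPreconnected C ∧ z ∈ C ∧
        Disjoint C (Metric.closedBall 0 a ∪ slitRing M a b τ) ∧ ¬ Bornology.IsBounded C := by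
    intro z hz hz'
    have hn : ∀ t : ℝ, 1 ≤ t → ‖(t : ℂ) * z‖ = t * ‖z‖ := fun t ht => by
      rw [norm_mul, Complex.norm_real, Real.norm_eq_abs, abs_of_nonneg (by linarith)]
    have hzpos : 0 < ‖z‖ := ha.trans hz
    refine ⟨(fun t : ℝ => (t : ℂ) * z) '' Ici 1, isPreconnected_Ici.image _ (by fun_prop),
      ⟨1, mem_Ici.2 le_rfl, by simp⟩, ?_, fun hb => ?_⟩
    · rw [Set.disjoint_left]
      rintro _ ⟨t, ht, rfl⟩ hmem
      rw [mem_Ici] at ht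
      have hmono : ‖z‖ ≤ t * ‖z‖ := by nlinarith
      rcases hmem with hmem | ⟨-, h2, h3⟩
      · rw [mem_closedBall_zero_iff, hn t ht] at hmem
        linarith
      · rw [hn t ht] at h2
        rcases hz' with hz' | ⟨j, hj, hz'⟩
        · linarith
        · have := h3 j hj
          rw [hn t ht, raySep_real_mul, abs_mul, abs_of_nonneg (by linarith : (0 : ℝ) ≤ t)] at this
          nlinarith
    · obtain ⟨B, hB⟩ := hb.exists_norm_le
      have hB1 := hB _ ⟨max 1 ((B + 1) / ‖z‖), mem_Ici.2 (le_max_left _ _), rfl⟩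
      rw [hn _ (le_max_left _ _)] at hB1
      have : B + 1 ≤ max 1 ((B + 1) / ‖z‖) * ‖z‖ := by
        rw [← div_le_iff₀ hzpos]; exact le_max_right _ _
      linarith
  intro z hz
  rw [mem_union, not_or, mem_closedBall_zero_iff, not_le] at hz
  obtain ⟨hza, hzQ⟩ := hz
  by_cases h : b < ‖z‖ ∨ ∃ j ≤ M, |raySep M j z| < τ * ‖z‖
  · exact hray z hza h
  -- otherwise `z` lies in a round gap: go around it to the first slit
  push Not at h
  have hgap : ¬ (a + τ ≤ ‖z‖ ∧ ‖z‖ ≤ b - τ) := fun hc => hzQ ⟨hc.1, hc.2, h.2⟩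
  have hw : raySep M 0 (-(‖z‖ : ℂ)) = 0 := by
    have h0 : (-(‖z‖ : ℂ)) = ((-‖z‖ : ℝ) : ℂ) * 1 := by push_cast; ring
    rw [h0, raySep_real_mul]
    simp [raySep, Complex.exp_pi_mul_I]
  obtain ⟨C, hC, hwC, hCd, hCb⟩ := hray (-(‖z‖ : ℂ)) (by simpa using hza)
    (Or.inr ⟨0, Nat.zero_le _, by
      rw [hw, abs_zero]
      have : 0 < ‖z‖ := ha.trans hza
      simpa using mul_pos hτ this⟩)
  refine ⟨(fun t : ℝ => (‖z‖ : ℂ) * Complex.exp (t * Complex.I)) '' univ ∪ C,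
    (isPreconnected_univ.image _ (by fun_prop)).union (-(‖z‖ : ℂ)) ⟨Real.pi, trivial, by
      simp [Complex.exp_pi_mul_I]⟩ hwC hC,
    Or.inl ⟨z.arg, trivial, Complex.norm_mul_exp_arg_mul_I z⟩, ?_,
    fun hb => hCb (hb.subset subset_union_right)⟩
  refine Set.disjoint_union_left.2 ⟨?_, hCd⟩
  rw [Set.disjoint_left]
  rintro _ ⟨t, -, rfl⟩ hmem
  have hn : ‖(‖z‖ : ℂ) * Complex.exp (t * Complex.I)‖ = ‖z‖ := by
    rw [norm_mul, Complex.norm_exp_ofReal_mul_I, mul_one, Complex.norm_real, norm_norm]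
  rcases hmem with hmem | ⟨h1, h2, -⟩
  · rw [mem_closedBall_zero_iff, hn] at hmem
    linarith
  · rw [hn] at h1 h2
    exact hgap ⟨h1, h2⟩

/-! ### Simultaneous approximation on a disc and a slit ring -/

/-- A polynomial on a disc and a function on a slit ring around it, constant on the sectors cut out
by the slits, are approximated simultaneously by a polynomial. -/
theorem exists_polynomial_near_sectors {M : ℕ} {a b τ : ℝ} (ha : 0 < a) (hb : b ≤ 1) (hτ : 0 < τ)
    (F : Polynomial ℂ) (Φ : (Fin (M + 1) → Bool) → ℂ) {ε : ℝ} (hε : 0 < ε) :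
    ∃ P : Polynomial ℂ, (∀ z : ℂ, ‖z‖ ≤ a → dist (P.eval z) (F.eval z) ≤ ε) ∧
      ∀ z ∈ slitRing M a b τ, dist (P.eval z) (Φ fun j => decide (0 < raySep M j z)) ≤ ε := by
  classical
  set Q := slitRing M a b τ with hQ
  set K : Set ℂ := Metric.closedBall 0 a ∪ Q
  have hKc : IsCompact K := (isCompact_closedBall _ _).union (isCompact_slitRing M a b τ)
  have : CompactSpace K := isCompact_iff_compactSpace.1 hKc
  have : Nonempty K := ⟨⟨0, Or.inl (Metric.mem_closedBall_self ha.le)⟩⟩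
  have hK : EscapesToInfinity K := escapesToInfinity_closedBall_union_slitRing M ha hτ
  have hcases : ∀ x : K, ‖(x : ℂ)‖ ≤ a ∨ (x : ℂ) ∈ Q := fun x =>
    x.2.imp_left mem_closedBall_zero_iff.1
  have hQa : ∀ z ∈ Q, a + τ ≤ ‖z‖ := fun z hz => hz.1
  -- the indicator function of the disc
  have hρ : 0 < a + τ / 2 := by positivity
  set ℓ : Polynomial ℂ := Polynomial.C ((a + τ / 2 : ℝ) : ℂ)⁻¹ * Polynomial.X with hℓ
  have hℓn : ∀ x : K, ‖ℓ.toContinuousMapOn K x‖ = ‖(x : ℂ)‖ / (a + τ / 2) := by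
    intro x
    have h : ℓ.toContinuousMapOn K x = ((a + τ / 2 : ℝ) : ℂ)⁻¹ * x := by simp [hℓ]
    rw [h, norm_mul, norm_inv, Complex.norm_real, Real.norm_eq_abs, abs_of_pos hρ, inv_mul_eq_div]
  obtain ⟨e, he, he1, he0⟩ := exists_indicator_mem_polyAlg hK (polynomial_mem_polyAlg ℓ) (by
    intro x
    rw [hℓn, ne_eq, div_eq_one_iff_eq hρ.ne']
    rcases hcases x with h | h
    · linarith
    · linarith [hQa _ h])
  simp only [hℓn, div_lt_one hρ, one_lt_div hρ] at he1 he0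
  have heA : ∀ x : K, ‖(x : ℂ)‖ ≤ a → e x = 1 := fun x hx => he1 x (by linarith)
  have heQ : ∀ x : K, (x : ℂ) ∈ Q → e x = 0 := fun x hx => he0 x (by linarith [hQa _ hx])
  -- the half planes, separated on the ring by large circles
  set c : ℝ := τ * a with hc
  have hcpos : 0 < c := by positivity
  have hside : ∀ j : Fin (M + 1), ∃ s ∈ polyAlg K, (∀ x : K, ‖(x : ℂ)‖ ≤ a → s x = 1) ∧
      ∀ x : K, (x : ℂ) ∈ Q → s x = if 0 < raySep M j x then 1 else 0 := by
    intro j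
    set u : ℂ := Complex.exp (-(((-Real.pi + (j : ℕ) * (2 * Real.pi / M) : ℝ) : ℂ) * Complex.I))
      with hu
    have hun : ‖u‖ = 1 := by
      rw [hu, ← neg_mul, ← Complex.ofReal_neg, Complex.norm_exp_ofReal_mul_I]
    have hL : ∀ z, raySep M j z = (z * u).im := fun z => rfl
    -- `‖p‖ < 1` is a disc of radius `1/c` tangent at `0` to the line `raySep M j = 0`. It agrees
    -- with the half plane on `Q`, where `|raySep| ≥ τ‖z‖ > c ≥ c‖z‖ ^ 2`.
    set p : Polynomial ℂ := Polynomial.C (c : ℂ) * (Polynomial.X * Polynomial.C u) -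
      Polynomial.C Complex.I with hp
    have hpn : ∀ z, ‖p.eval z‖ ^ 2 = c ^ 2 * ‖z‖ ^ 2 - 2 * c * raySep M j z + 1 := by
      intro z
      have h1 : ‖z‖ ^ 2 = (z * u).re ^ 2 + (z * u).im ^ 2 := by
        have : ‖z‖ = ‖z * u‖ := by rw [norm_mul, hun, mul_one]
        rw [this, Complex.sq_norm, Complex.normSq_apply]; ring
      have h2 : p.eval z = (c : ℂ) * (z * u) - Complex.I := by
        simp only [hp, Polynomial.eval_sub, Polynomial.eval_mul, Polynomial.eval_C,
          Polynomial.eval_X]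
      rw [h2, h1, hL, Complex.sq_norm, Complex.normSq_apply, Complex.sub_re, Complex.sub_im,
        Complex.re_ofReal_mul, Complex.im_ofReal_mul, Complex.I_re, Complex.I_im]
      ring
    have hQz : ∀ z ∈ Q, (0 < raySep M j z → ‖p.eval z‖ < 1) ∧
        (¬ 0 < raySep M j z → 1 < ‖p.eval z‖) := by
      intro z hz
      have h1 : ‖z‖ ≤ 1 := by linarith [hz.2.1]
      have h2 : c < |raySep M j z| := by
        have := hz.2.2 j (by omega)
        have h3 := hQa z hz
        nlinarith
      have h4 := hpn z
      have h5 := norm_nonneg (p.eval z)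
      have h6 : ‖z‖ ^ 2 ≤ 1 := by nlinarith [norm_nonneg z]
      constructor
      · intro h
        rw [abs_of_pos h] at h2
        have : ‖p.eval z‖ ^ 2 < 1 := by
          have : c ^ 2 * ‖z‖ ^ 2 ≤ c ^ 2 := by nlinarith [sq_nonneg c]
          nlinarith
        nlinarith
      · intro h
        rw [abs_of_nonpos (not_lt.1 h)] at h2
        have : 1 < ‖p.eval z‖ ^ 2 := by
          have : 0 ≤ c ^ 2 * ‖z‖ ^ 2 := by positivity
          nlinarith
        nlinarith
    -- On the inner disc `‖p‖` does take the value `1`, for instance at `0`; the factor `1 - e`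
    -- replaces `p` by `0` there.
    have hgm : (1 - e) * p.toContinuousMapOn K ∈ polyAlg K :=
      mul_mem (sub_mem (one_mem _) he) (polynomial_mem_polyAlg p)
    have hgA : ∀ x : K, ‖(x : ℂ)‖ ≤ a → ((1 - e) * p.toContinuousMapOn K) x = 0 := fun x hx => by
      simp [heA x hx]
    have hgQ : ∀ x : K, (x : ℂ) ∈ Q → ((1 - e) * p.toContinuousMapOn K) x = p.eval (x : ℂ) :=
      fun x hx => by simp [heQ x hx]
    obtain ⟨s, hs, hs1, hs0⟩ := exists_indicator_mem_polyAlg hK hgm (by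
      intro x
      rcases hcases x with h | h
      · rw [hgA x h]; simp
      · rw [hgQ x h]
        by_cases h0 : 0 < raySep M j x
        · exact ((hQz _ h).1 h0).ne
        · exact ((hQz _ h).2 h0).ne')
    refine ⟨s, hs, fun x hx => hs1 x (by rw [hgA x hx]; simp), fun x hx => ?_⟩
    split_ifs with h0
    · exact hs1 x (by rw [hgQ x hx]; exact (hQz _ hx).1 h0)
    · exact hs0 x (by rw [hgQ x hx]; exact (hQz _ hx).2 h0)
  choose s hs hsA hsQ using hside
  obtain ⟨g, hg, hgv⟩ := exists_mem_polyAlg_of_idempotents hs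
    (fun x j => decide (‖(x : ℂ)‖ ≤ a ∨ 0 < raySep M j x)) (by
      intro x j
      rcases hcases x with h | h
      · simp [hsA j x h, h]
      · have : ¬ ‖(x : ℂ)‖ ≤ a := by linarith [hQa _ h]
        simp [hsQ j x h, this]) Φ
  obtain ⟨P, hP⟩ := exists_polynomial_near
    (add_mem (mul_mem he (polynomial_mem_polyAlg F)) (mul_mem (sub_mem (one_mem _) he) hg)) hε
  refine ⟨P, fun z hz => ?_, fun z hz => ?_⟩
  · have := hP ⟨z, Or.inl (mem_closedBall_zero_iff.2 hz)⟩
    simpa [heA ⟨z, Or.inl (mem_closedBall_zero_iff.2 hz)⟩ hz] using this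
  · have := hP ⟨z, Or.inr hz⟩
    have hn : ¬ ‖z‖ ≤ a := by linarith [hQa _ hz]
    simpa [heQ ⟨z, Or.inr hz⟩ hz, hgv, hn] using this

/-- Inside the ring `a ≤ ‖z‖ < b` there is a compact set of almost full area on which a function of
small oscillation is approximated by polynomials that stay close to a given one on `‖z‖ ≤ a`. -/
theorem exists_compact_approx_in_ring {G : ℂ → ℂ} {a b η ε : ℝ} (ha : 0 < a) (hb : b ≤ 1)
    (hη : b - a < η)
    (hG : ∀ z w : ℂ, ‖z‖ ≤ 1 → ‖w‖ ≤ 1 → dist z w < η → dist (G z) (G w) ≤ ε)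
    {v : ENNReal} (hv : 0 < v) :
    ∃ Q : Set ℂ, IsCompact Q ∧ (∀ z ∈ Q, a < ‖z‖ ∧ ‖z‖ < b) ∧
      volume ({z : ℂ | a ≤ ‖z‖ ∧ ‖z‖ < b} \ Q) ≤ v ∧
      ∀ (F : Polynomial ℂ) (ε' : ℝ), 0 < ε' → ∃ P : Polynomial ℂ,
        (∀ z : ℂ, ‖z‖ ≤ a → dist (P.eval z) (F.eval z) ≤ ε') ∧
        ∀ z ∈ Q, dist (P.eval z) (G z) ≤ ε + ε' := by
  classical
  obtain ⟨M, hM, hMη⟩ : ∃ M : ℕ, 2 ≤ M ∧ b - a + 2 * Real.pi / M < η := by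
    have h : Tendsto (fun M : ℕ => b - a + 2 * Real.pi / (M : ℝ)) atTop (𝓝 (b - a + 0)) :=
      tendsto_const_nhds.add (tendsto_const_div_atTop_nhds_zero_nat _)
    rw [add_zero] at h
    obtain ⟨M, h1, h2⟩ := ((h.eventually (gt_mem_nhds hη)).and (eventually_ge_atTop 2)).exists
    exact ⟨M, h2, h1⟩
  obtain ⟨τ, hτ, hvol⟩ := exists_volume_diff_slitRing_le M (b := b) ha hv
  refine ⟨slitRing M a b τ, isCompact_slitRing M a b τ, fun z hz =>
    ⟨by linarith [hz.1], by linarith [hz.2.1]⟩, hvol, fun F ε' hε' => ?_⟩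
  let pat : ℂ → Fin (M + 1) → Bool := fun z j => decide (0 < raySep M j z)
  -- One sample of `G` per sector; `0` serves sign patterns that do not occur on the slit ring.
  let Φ : (Fin (M + 1) → Bool) → ℂ := fun v =>
    if h : ∃ q ∈ slitRing M a b τ, pat q = v then G h.choose else 0
  obtain ⟨P, hPA, hPQ⟩ := exists_polynomial_near_sectors (M := M) ha hb hτ F Φ hε'
  refine ⟨P, hPA, fun z hz => ?_⟩
  have hex : ∃ q ∈ slitRing M a b τ, pat q = pat z := ⟨z, hz, rfl⟩
  have hΦ : Φ (pat z) = G hex.choose := dif_pos hex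
  obtain ⟨hq, hqz⟩ := hex.choose_spec
  have h1 := hPQ z hz
  change dist _ (Φ (pat z)) ≤ ε' at h1
  rw [hΦ] at h1
  generalize hex.choose = q at hq hqz h1
  have hclose : dist q z < η := by
    have hpos : ∀ j ≤ M, raySep M j q ≠ 0 := fun j hj h0 => by
      have := hq.2.2 j hj
      rw [h0, abs_zero] at this
      nlinarith [hq.1]
    refine (dist_le_of_raySep_pos_iff hM hpos fun j hj => ?_).trans_lt (lt_of_le_of_lt ?_ hMη)
    · have := congrFun hqz ⟨j, by omega⟩
      simpa [pat] using this
    · have hz1 : ‖z‖ ≤ 1 := by linarith [hz.2.1]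
      refine add_le_add ?_ (mul_le_of_le_one_left (by positivity) hz1)
      rw [abs_le]
      constructor <;> linarith [hq.1, hq.2.1, hz.1, hz.2.1]
  have h2 := hG q z (by linarith [hq.2.1]) (by linarith [hz.2.1]) hclose
  linarith [dist_triangle (P.eval z) (G q) (G z)]

/-! ### Continuous approximation of the boundary data -/

/-- **Lusin's theorem**. -/
theorem exists_isCompact_continuousOn {α β : Type*} [TopologicalSpace α] [T2Space α]
    [MeasurableSpace α] [BorelSpace α] [TopologicalSpace β] [SecondCountableTopology β]
    [MeasurableSpace β] [OpensMeasurableSpace β] {μ : Measure α} [μ.InnerRegularCompactLTTop]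
    {ψ : α → β} {A : Set α} (hA : MeasurableSet A) (hfin : μ A ≠ ⊤)
    (hψ : AEMeasurable ψ (μ.restrict A)) {ε : ENNReal} (hε : ε ≠ 0) :
    ∃ L ⊆ A, IsCompact L ∧ ContinuousOn ψ L ∧ μ (A \ L) ≤ ε := by
  classical
  obtain ⟨N, hN, hNm, hN0⟩ := exists_measurable_superset_of_null (ae_iff.1 hψ.ae_eq_mk)
  rw [Measure.restrict_apply hNm] at hN0
  set B := A \ N with hB
  have hBm : MeasurableSet B := hA.diff hNm
  have hBfin : μ B ≠ ⊤ := ((measure_mono sdiff_subset).trans_lt hfin.lt_top).ne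
  have hBψ : ∀ x ∈ B, ψ x = hψ.mk ψ x := fun x hx => by
    by_contra h
    exact hx.2 (hN h)
  have hε3 : ε / 3 ≠ 0 := (ENNReal.div_pos hε (by simp)).ne'
  obtain ⟨ε', hε', hsum⟩ := ENNReal.exists_pos_sum_of_countable' hε3
    (TopologicalSpace.countableBasis β)
  have hVm : ∀ V : TopologicalSpace.countableBasis β, MeasurableSet (hψ.mk ψ ⁻¹' V) := fun V =>
    hψ.measurable_mk (TopologicalSpace.isOpen_of_mem_countableBasis V.2).measurableSet
  have hfin' : ∀ T : Set α, μ (B ∩ T) ≠ ⊤ := fun T =>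
    ((measure_mono inter_subset_left).trans_lt hBfin.lt_top).ne
  -- Each preimage of a basic open set and its complement in `B` are replaced by compact sets `C V`,
  -- `D V` with summable losses. On the intersection of all `C V ∪ D V`, the preimage of `V` is the
  -- complement of the closed `D V`, hence relatively open.
  choose C hCB hCc hCε using fun V : TopologicalSpace.countableBasis β =>
    (hBm.inter (hVm V)).exists_isCompact_sdiff_lt (hfin' _) (hε' V).ne'
  choose D hDB hDc hDε using fun V : TopologicalSpace.countableBasis β =>
    (hBm.inter (hVm V).compl).exists_isCompact_sdiff_lt (hfin' _) (hε' V).ne'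
  obtain ⟨K, hKB, hKc, hKε⟩ := hBm.exists_isCompact_sdiff_lt hBfin hε3
  refine ⟨K ∩ ⋂ V : TopologicalSpace.countableBasis β, (C V ∪ D V), fun x hx => (hKB hx.1).1,
    hKc.inter_right (isClosed_iInter fun V => ((hCc V).union (hDc V)).isClosed), ?_, ?_⟩
  · intro x hx
    rw [ContinuousWithinAt,
      (TopologicalSpace.isBasis_countableBasis β).nhds_hasBasis.tendsto_right_iff]
    rintro V ⟨hV, hxV⟩
    have hxD : x ∉ D ⟨V, hV⟩ := fun h => (hDB _ h).2 (by
      rw [mem_preimage, ← hBψ x (hKB hx.1)]; exact hxV)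
    filter_upwards [self_mem_nhdsWithin,
      mem_nhdsWithin_of_mem_nhds ((hDc ⟨V, hV⟩).isClosed.isOpen_compl.mem_nhds hxD)] with y hy hyD
    have hyC : y ∈ C ⟨V, hV⟩ := (mem_iInter.1 hy.2 ⟨V, hV⟩).resolve_right hyD
    rw [hBψ y (hKB hy.1)]
    exact (hCB _ hyC).2
  · have hsub : A \ (K ∩ ⋂ V : TopologicalSpace.countableBasis β, (C V ∪ D V)) ⊆ (N ∩ A ∪ B \ K) ∪
        ((⋃ V : TopologicalSpace.countableBasis β, (B ∩ hψ.mk ψ ⁻¹' V) \ C V) ∪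
          ⋃ V : TopologicalSpace.countableBasis β, (B ∩ (hψ.mk ψ ⁻¹' V)ᶜ) \ D V) := by
      rintro x ⟨hxA, hx⟩
      by_cases hxN : x ∈ N
      · exact Or.inl (Or.inl ⟨hxN, hxA⟩)
      by_cases hxK : x ∈ K
      · right
        have : ∃ V, x ∉ C V ∪ D V := by
          by_contra hcon
          push Not at hcon
          exact hx ⟨hxK, mem_iInter.2 hcon⟩
        obtain ⟨V, hV⟩ := this
        rw [mem_union, not_or] at hV
        by_cases hxV : x ∈ hψ.mk ψ ⁻¹' V
        · exact Or.inl (mem_iUnion.2 ⟨V, ⟨⟨hxA, hxN⟩, hxV⟩, hV.1⟩)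
        · exact Or.inr (mem_iUnion.2 ⟨V, ⟨⟨hxA, hxN⟩, hxV⟩, hV.2⟩)
      · exact Or.inl (Or.inr ⟨⟨hxA, hxN⟩, hxK⟩)
    have hU : ∀ T : TopologicalSpace.countableBasis β → Set α, (∀ V, μ (T V) < ε' V) →
        μ (⋃ V, T V) ≤ ε / 3 := fun T hT =>
      (measure_iUnion_le T).trans ((ENNReal.tsum_le_tsum fun V => (hT V).le).trans hsum.le)
    refine (measure_mono hsub).trans ((measure_union_le _ _).trans ?_)
    calc μ (N ∩ A ∪ B \ K) + μ ((⋃ V : TopologicalSpace.countableBasis β, (B ∩ hψ.mk ψ ⁻¹' V) \ C V) ∪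
          ⋃ V : TopologicalSpace.countableBasis β, (B ∩ (hψ.mk ψ ⁻¹' V)ᶜ) \ D V)
        ≤ (0 + ε / 3) + (ε / 3 + ε / 3) := by
          refine add_le_add ((measure_union_le _ _).trans (add_le_add hN0.le hKε.le))
            ((measure_union_le _ _).trans (add_le_add (hU _ hCε) (hU _ hDε)))
      _ = ε := by rw [zero_add, ← add_assoc, ENNReal.add_thirds]

/-- A function on `[0, 2π)`, continuous on a relatively closed set `S`, is the limit on `S` and
almost everywhere of functions that are continuous on the circle. -/
theorem exists_continuousMap_eventually_eq {ψ : ℝ → ℂ} {S : Set ℝ}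
    (hψ : AEMeasurable ψ (volume.restrict (Ico 0 (2 * Real.pi))))
    (hS : IsClosedIn S (Ico 0 (2 * Real.pi))) (hψS : ContinuousOn ψ S) :
    ∃ G : ℕ → C(ℂ, ℂ),
      (∀ θ ∈ S, ∀ᶠ n in atTop, G n (Complex.exp ((θ : ℂ) * Complex.I)) = ψ θ) ∧
      ∀ᵐ θ : ℝ ∂(volume.restrict (Ico 0 (2 * Real.pi))),
        ∀ᶠ n in atTop, G n (Complex.exp ((θ : ℂ) * Complex.I)) = ψ θ := by
  obtain ⟨C, hC, rfl⟩ := hS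
  set I := Ico 0 (2 * Real.pi) with hI
  have hSm : MeasurableSet (C ∩ I) := hC.measurableSet.inter measurableSet_Ico
  have hAm : MeasurableSet (I \ (C ∩ I)) := measurableSet_Ico.diff hSm
  have hAfin : volume (I \ (C ∩ I)) ≠ ⊤ :=
    ((measure_mono sdiff_subset).trans_lt measure_Ico_lt_top).ne
  obtain ⟨ε, hε, hsum⟩ := ENNReal.exists_pos_sum_of_countable' (one_ne_zero (α := ENNReal)) ℕ
  choose L hLA hLc hLψ hLε using fun n => exists_isCompact_continuousOn hAm hAfin
    (hψ.mono_measure (Measure.restrict_mono sdiff_subset le_rfl)) (hε n).ne'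
  -- `S` may accumulate at `2π`; truncation makes it compact while staying in `[0, 2π)`, where `θ ↦
  -- exp (iθ)` is injective.
  let T : ℕ → Set ℝ := fun n => C ∩ Icc 0 (2 * Real.pi - 1 / ((n : ℝ) + 1))
  have hTI : ∀ n, T n ⊆ C ∩ I := fun n θ hθ => ⟨hθ.1, hθ.2.1, by
    have : 0 < 1 / ((n : ℝ) + 1) := by positivity
    linarith [hθ.2.2]⟩
  have hTc : ∀ n, IsCompact (T n) := fun n => isCompact_Icc.inter_left hC
  have hRI : ∀ n, T n ∪ L n ⊆ I := fun n =>
    union_subset ((hTI n).trans inter_subset_right) ((hLA n).trans sdiff_subset)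
  have hRψ : ∀ n, ContinuousOn ψ (T n ∪ L n) := fun n =>
    (hψS.mono (hTI n)).union_of_isClosed (hLψ n) (hTc n).isClosed (hLc n).isClosed
  have hG : ∀ n, ∃ G : C(ℂ, ℂ), ∀ θ ∈ T n ∪ L n,
      G (Complex.exp ((θ : ℂ) * Complex.I)) = ψ θ := by
    intro n
    have : CompactSpace ↥(T n ∪ L n) := isCompact_iff_compactSpace.1 ((hTc n).union (hLc n))
    have hcont : Continuous fun θ : ↥(T n ∪ L n) =>
        Complex.exp (((θ : ℝ) : ℂ) * Complex.I) := by fun_prop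
    have hinj : Function.Injective fun θ : ↥(T n ∪ L n) =>
        Complex.exp (((θ : ℝ) : ℂ) * Complex.I) := by
      intro x y hxy
      have hx := hRI n x.2
      have hy := hRI n y.2
      obtain ⟨k, hk⟩ := Complex.exp_eq_exp_iff_exists_int.1 hxy
      have hk' : (x : ℝ) = y + k * (2 * Real.pi) := by
        have h := congrArg Complex.im hk
        simpa using h
      have hπ := Real.two_pi_pos
      have hk1 : (k : ℝ) < 1 := by
        by_contra hcon
        nlinarith [hx.2, hy.1]
      have hk2 : (-1 : ℝ) < k := by
        by_contra hcon
        nlinarith [hx.1, hy.2]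
      have hk0 : k = 0 := by
        have h1 : k < 1 := by exact_mod_cast hk1
        have h2 : -1 < k := by exact_mod_cast hk2
        omega
      rw [hk0] at hk'
      exact Subtype.ext (by simpa using hk')
    obtain ⟨G, hG⟩ := ContinuousMap.exists_extension' (hcont.isClosedEmbedding hinj)
      ⟨fun θ : ↥(T n ∪ L n) => ψ θ, (hRψ n).domRestrict⟩
    exact ⟨G, fun θ hθ => congrFun hG ⟨θ, hθ⟩⟩
  choose G hG using hG
  have hSev : ∀ θ ∈ C ∩ I, ∀ᶠ n in atTop, G n (Complex.exp ((θ : ℂ) * Complex.I)) = ψ θ := by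
    intro θ hθ
    have : ∀ᶠ n : ℕ in atTop, 1 / ((n : ℝ) + 1) < 2 * Real.pi - θ :=
      (tendsto_one_div_add_atTop_nhds_zero_nat (𝕜 := ℝ)).eventually
        (gt_mem_nhds (by linarith [hθ.2.2]))
    filter_upwards [this] with n hn
    exact hG n θ (Or.inl ⟨hθ.1, hθ.2.1, by linarith⟩)
  refine ⟨G, hSev, ?_⟩
  have hBC := ae_eventually_notMem (μ := volume) (s := fun n => (I \ (C ∩ I)) \ L n)
    ((ENNReal.tsum_le_tsum hLε).trans_lt (hsum.trans ENNReal.one_lt_top)).ne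
  filter_upwards [ae_restrict_of_ae hBC, ae_restrict_mem measurableSet_Ico] with θ hθ hθI
  by_cases hθS : θ ∈ C ∩ I
  · exact hSev θ hθS
  · filter_upwards [hθ] with n hn
    refine hG n θ (Or.inr ?_)
    by_contra hcon
    exact hn ⟨⟨hθI, hθS⟩, hcon⟩

/-! ### Area and density at a boundary point, limits of polynomials -/

theorem quarter_le_volume_ball_inter_unitDisc {p : ℂ} (hp : ‖p‖ = 1) {r : ℝ} (hr : 0 < r)
    (hr2 : r ≤ 2) : Real.pi / 4 * r ^ 2 ≤ volume.real (Metric.ball p r ∩ unitDisc) := by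
  -- This disc of radius `r / 2` touches the unit circle at `p` from inside.
  have hsub : Metric.ball (((1 - r / 2 : ℝ) : ℂ) * p) (r / 2) ⊆ Metric.ball p r ∩ unitDisc := by
    refine subset_inter (Metric.ball_subset_ball' ?_) (Metric.ball_subset_ball' ?_)
    · have : ((1 - r / 2 : ℝ) : ℂ) * p - p = ((-(r / 2) : ℝ) : ℂ) * p := by push_cast; ring
      rw [dist_eq_norm, this, norm_mul, hp, Complex.norm_real, Real.norm_eq_abs, abs_neg,
        abs_of_pos (by positivity)]
      linarith
    · rw [dist_zero_right, norm_mul, hp, Complex.norm_real, Real.norm_eq_abs,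
        abs_of_nonneg (by linarith)]
      linarith
  have hfin : volume (Metric.ball p r ∩ unitDisc) ≠ ⊤ :=
    ((measure_mono inter_subset_left).trans_lt measure_ball_lt_top).ne
  refine le_trans (le_of_eq ?_) (measureReal_mono hsub hfin)
  rw [Measure.real, Complex.volume_ball, ENNReal.toReal_mul, ENNReal.toReal_pow,
    ENNReal.toReal_ofReal (by positivity)]
  simp
  ring

/-- A subset of the disc that leaves out only area `O(r ^ 3)` within distance `r` of `p` has
density `1` at `p`. -/
theorem hasRelDensity_one_of_volume_diff_le {E : Set ℂ} {p : ℂ} {c r₀ : ℝ} (hp : ‖p‖ = 1)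
    (hE : MeasurableSet E) (hED : E ⊆ unitDisc) (hr₀ : 0 < r₀)
    (h : ∀ r, 0 < r → r < r₀ → volume.real ((Metric.ball p r ∩ unitDisc) \ E) ≤ c * r ^ 3) :
    HasRelDensity E unitDisc p 1 := by
  have hπ := Real.pi_pos
  have hlim : Tendsto (fun r : ℝ => 1 - c * r * (4 / Real.pi)) (𝓝[>] 0) (𝓝 1) := by
    have : Tendsto (fun r : ℝ => 1 - c * r * (4 / Real.pi)) (𝓝 0)
        (𝓝 (1 - c * 0 * (4 / Real.pi))) :=
      Continuous.tendsto (by fun_prop) 0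
    simp only [mul_zero, zero_mul, sub_zero] at this
    exact this.mono_left nhdsWithin_le_nhds
  have hsmall : ∀ᶠ r : ℝ in 𝓝[>] 0, 0 < r ∧ r < r₀ ∧ r ≤ 2 := by
    filter_upwards [Ioo_mem_nhdsGT hr₀, Ioo_mem_nhdsGT (zero_lt_two (α := ℝ))] with r h1 h2
    exact ⟨h1.1, h1.2, h2.2.le⟩
  have hfin : ∀ r, volume (Metric.ball p r ∩ unitDisc) ≠ ⊤ := fun r =>
    ((measure_mono inter_subset_left).trans_lt measure_ball_lt_top).ne
  refine tendsto_of_tendsto_of_tendsto_of_le_of_le' hlim tendsto_const_nhds ?_ ?_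
  · filter_upwards [hsmall] with r ⟨hr, hr1, hr2⟩
    have hlow := quarter_le_volume_ball_inter_unitDisc hp hr hr2
    have hpos : 0 < volume.real (Metric.ball p r ∩ unitDisc) := lt_of_lt_of_le (by positivity) hlow
    have hsplit := measureReal_inter_add_sdiff (μ := volume)
      (s := Metric.ball p r ∩ unitDisc) hE (hfin r)
    have heq : Metric.ball p r ∩ unitDisc ∩ E = Metric.ball p r ∩ E := by
      rw [inter_assoc, inter_eq_right.2 hED]
    rw [heq] at hsplit
    rw [le_div_iff₀ hpos]
    have h1 := h r hr hr1
    have h0 : 0 ≤ volume.real ((Metric.ball p r ∩ unitDisc) \ E) := measureReal_nonneg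
    have hc : 0 ≤ c * r := by
      have : 0 ≤ c * r * r ^ 2 := by nlinarith
      exact nonneg_of_mul_nonneg_left this (by positivity)
    have h2 : c * r ^ 3 ≤ c * r * (4 / Real.pi) * volume.real (Metric.ball p r ∩ unitDisc) := by
      calc c * r ^ 3 = c * r * (4 / Real.pi) * (Real.pi / 4 * r ^ 2) := by field_simp
        _ ≤ _ := mul_le_mul_of_nonneg_left hlow (by positivity)
    linarith
  · filter_upwards with r
    refine div_le_one_of_le₀ (measureReal_mono (inter_subset_inter_right _ hED) (hfin r))
      measureReal_nonneg

theorem exists_strictAnti_lt {η : ℕ → ℝ} (hη : ∀ n, 0 < η n) :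
    ∃ δ : ℕ → ℝ, StrictAnti δ ∧ (∀ n, 0 < δ n) ∧ (∀ n, δ n < η n) ∧ (∀ n, δ n < 1) ∧
      Tendsto δ atTop (𝓝 0) := by
  let δ : ℕ → ℝ := fun n => Nat.rec (min 1 (η 0) / 2) (fun k d => min d (η (k + 1)) / 2) n
  have hs : ∀ n, δ (n + 1) = min (δ n) (η (n + 1)) / 2 := fun n => rfl
  have hpos : ∀ n, 0 < δ n := by
    intro n
    induction n with
    | zero => exact half_pos (lt_min one_pos (hη 0))
    | succ n ih => rw [hs]; exact half_pos (lt_min ih (hη _))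
  have hhalf : ∀ n, δ (n + 1) ≤ δ n / 2 := fun n => by
    rw [hs]; linarith [min_le_left (δ n) (η (n + 1))]
  have h0 : δ 0 ≤ 1 / 2 := by
    change min 1 (η 0) / 2 ≤ _
    linarith [min_le_left 1 (η 0)]
  have hgeo : ∀ n, δ n ≤ (1 / 2) ^ n * (1 / 2) := by
    intro n
    induction n with
    | zero => simpa using h0
    | succ n ih => rw [pow_succ]; linarith [hhalf n]
  refine ⟨δ, strictAnti_nat_of_succ_lt fun n => by linarith [hhalf n, hpos n], hpos, ?_, ?_, ?_⟩
  · rintro (_ | n)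
    · change min 1 (η 0) / 2 < _
      linarith [min_le_right 1 (η 0), hη 0]
    · rw [hs]
      linarith [min_le_right (δ n) (η (n + 1)), hη (n + 1)]
  · intro n
    have : ((1 : ℝ) / 2) ^ n ≤ 1 := pow_le_one₀ (by norm_num) (by norm_num)
    linarith [hgeo n]
  · refine squeeze_zero (fun n => (hpos n).le) hgeo ?_
    have := (tendsto_pow_atTop_nhds_zero_of_lt_one (r := (1 / 2 : ℝ)) (by norm_num)
      (by norm_num)).mul_const (1 / 2 : ℝ)
    rwa [zero_mul] at this

/-- The errors from index `n` on sum to `1 / 2 ^ n`, so convergence is locally uniform on the open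
disc. -/
theorem exists_limit_of_geometric_approx {a : ℕ → ℝ} (ha : Monotone a)
    (ha1 : Tendsto a atTop (𝓝 1)) {F : ℕ → Polynomial ℂ}
    (hF : ∀ n z, ‖z‖ ≤ a n → dist ((F n).eval z) ((F (n + 1)).eval z) ≤ 1 / 2 / 2 ^ n) :
    ∃ f : ℂ → ℂ, DifferentiableOn ℂ f unitDisc ∧
      ∀ n z, ‖z‖ ≤ a n → dist ((F n).eval z) (f z) ≤ 1 / 2 ^ n := by
  have hstep : ∀ n z, ‖z‖ ≤ a n → ∀ k, dist ((F (k + n)).eval z) ((F (k + 1 + n)).eval z) ≤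
      1 / 2 ^ n / 2 / 2 ^ k := by
    intro n z hz k
    have h := hF (k + n) z (hz.trans (ha (by omega)))
    rw [show k + 1 + n = k + n + 1 by ring]
    refine h.trans (le_of_eq ?_)
    rw [pow_add]
    field_simp
  have hex : ∀ z : ℂ, ∃ w, (∃ n, ‖z‖ ≤ a n) → Tendsto (fun n => (F n).eval z) atTop (𝓝 w) := by
    intro z
    by_cases h : ∃ n, ‖z‖ ≤ a n
    · obtain ⟨n, hn⟩ := h
      obtain ⟨w, hw⟩ := cauchySeq_tendsto_of_complete
        (cauchySeq_of_le_geometric_two (hstep n z hn))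
      exact ⟨w, fun _ => (tendsto_add_atTop_iff_nat n).1 hw⟩
    · exact ⟨0, fun h' => absurd h' h⟩
  choose f hf using hex
  have hfd : ∀ n z, ‖z‖ ≤ a n → dist ((F n).eval z) (f z) ≤ 1 / 2 ^ n := by
    intro n z hz
    have := dist_le_of_le_geometric_two_of_tendsto₀ (hstep n z hz)
      ((tendsto_add_atTop_iff_nat n).2 (hf z ⟨n, hz⟩))
    simpa using this
  refine ⟨f, ?_, hfd⟩
  have hloc : TendstoLocallyUniformlyOn (fun n z => (F n).eval z) f atTop unitDisc := by
    rw [Metric.tendstoLocallyUniformlyOn_iff]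
    intro ε hε z hz
    have hz1 : ‖z‖ < 1 := mem_ball_zero_iff.1 hz
    obtain ⟨m, hm⟩ := (ha1.eventually (lt_mem_nhds hz1)).exists
    refine ⟨Metric.ball 0 (a m), mem_nhdsWithin_of_mem_nhds
      (Metric.isOpen_ball.mem_nhds (mem_ball_zero_iff.2 hm)), ?_⟩
    have hpow : Tendsto (fun n : ℕ => 1 / (2 : ℝ) ^ n) atTop (𝓝 0) := by
      simpa [one_div] using tendsto_pow_atTop_nhds_zero_of_lt_one (r := (2⁻¹ : ℝ)) (by norm_num)
        (by norm_num)
    filter_upwards [hpow.eventually (gt_mem_nhds hε), eventually_ge_atTop m] with n hn hmn y hy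
    rw [dist_comm]
    exact (hfd n y ((mem_ball_zero_iff.1 hy).le.trans (ha hmn))).trans_lt hn
  exact hloc.differentiableOn (Eventually.of_forall fun n => (F n).differentiable.differentiableOn)
    Metric.isOpen_ball

theorem volume_ball_diff_closedBall_le {ρ : ℝ} (hρ0 : 0 < ρ) (hρ1 : ρ ≤ 1) :
    volume.real (Metric.ball (0 : ℂ) 1 \ Metric.closedBall 0 (1 - ρ)) ≤ 2 * Real.pi * ρ := by
  rw [measureReal_sdiff (Metric.closedBall_subset_ball (by linarith))
    measurableSet_closedBall measure_ball_lt_top.ne, Measure.real, Measure.real,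
    Complex.volume_ball, Complex.volume_closedBall, ENNReal.toReal_mul, ENNReal.toReal_mul,
    ENNReal.toReal_pow, ENNReal.toReal_pow, ENNReal.toReal_ofReal (by linarith),
    ENNReal.toReal_ofReal (by linarith)]
  simp only [ENNReal.coe_toReal, NNReal.coe_real_pi]
  nlinarith [Real.pi_pos, mul_pos Real.pi_pos (pow_pos hρ0 2)]

/-- Consecutive rings `a n ≤ ‖z‖ < a (n + 1)` exhaust the part of the disc outside `‖z‖ < a 0`. -/
theorem exists_mem_ring {a : ℕ → ℝ} (ha1 : Tendsto a atTop (𝓝 1)) {z : ℂ} (hz : ‖z‖ < 1)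
    (h0 : a 0 ≤ ‖z‖) : ∃ n, a n ≤ ‖z‖ ∧ ‖z‖ < a (n + 1) := by
  classical
  have hex : ∃ n, ‖z‖ < a n := (ha1.eventually (lt_mem_nhds hz)).exists
  obtain ⟨k, hk⟩ : ∃ k, Nat.find hex = k + 1 := by
    refine Nat.exists_eq_succ_of_ne_zero fun h => ?_
    have := Nat.find_spec hex
    rw [h] at this
    linarith
  refine ⟨k, not_lt.1 (Nat.find_min hex (by omega)), ?_⟩
  rw [← hk]
  exact Nat.find_spec hex

/-- A family of compact sets that sit in consecutive rings is closed in the disc. -/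
theorem isClosedIn_unitDisc_iUnion {a : ℕ → ℝ} (ha : Monotone a)
    (ha1 : Tendsto a atTop (𝓝 1)) {Q : ℕ → Set ℂ} (hQc : ∀ n, IsCompact (Q n))
    (hQ : ∀ n, ∀ z ∈ Q n, a n < ‖z‖ ∧ ‖z‖ < 1) :
    IsClosedIn (⋃ n, Q n) unitDisc := by
  -- The `Q n` accumulate only at the unit circle: the `m`-th set is a finite union plus the outer
  -- region `a m ≤ ‖z‖`, and each point of the disc is outside that region for some `m`.
  refine ⟨⋂ m, ((⋃ n ∈ Finset.range m, Q n) ∪ {z | a m ≤ ‖z‖}), ?_, ?_⟩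
  · refine isClosed_iInter fun m => IsClosed.union ?_ (isClosed_le continuous_const continuous_norm)
    exact isClosed_biUnion_finset fun n _ => (hQc n).isClosed
  · ext z
    simp only [mem_iUnion, mem_inter_iff, mem_iInter, mem_union, Finset.mem_range, exists_prop,
      mem_ofPred_eq]
    constructor
    · rintro ⟨n, hn⟩
      refine ⟨fun m => ?_, mem_ball_zero_iff.2 (hQ n z hn).2⟩
      rcases lt_or_ge n m with h | h
      · exact Or.inl ⟨n, h, hn⟩
      · exact Or.inr ((ha h).trans (hQ n z hn).1.le)
    · rintro ⟨h, hz⟩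
      obtain ⟨m, hm⟩ := (ha1.eventually (lt_mem_nhds (mem_ball_zero_iff.1 hz))).exists
      rcases h m with ⟨n, -, hn⟩ | h
      · exact ⟨n, hn⟩
      · exact absurd h (not_le.2 hm)

/-- Compact sets that fill all but a small area of consecutive rings have a union that, cut down to
`‖z - p‖ ^ 3 ≤ 1 - ‖z‖`, has density `1` at `p`. -/
theorem hasRelDensity_iUnion_inter {δ : ℕ → ℝ} (hδpos : ∀ n, 0 < δ n) (hδ1 : ∀ n, δ n < 1)
    (hδ0 : Tendsto δ atTop (𝓝 0)) {Q : ℕ → Set ℂ} (hQc : ∀ n, IsCompact (Q n))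
    (hQ : ∀ n, ∀ z ∈ Q n, ‖z‖ < 1)
    (hvol : ∀ n, volume ({z : ℂ | 1 - δ n ≤ ‖z‖ ∧ ‖z‖ < 1 - δ (n + 1)} \ Q n) ≤
      ENNReal.ofReal (δ (n + 1) ^ 3 * (1 / 2) ^ n)) {p : ℂ} (hp : ‖p‖ = 1) :
    HasRelDensity ((⋃ n, Q n) ∩ {z | ‖z - p‖ ^ 3 ≤ 1 - ‖z‖}) unitDisc p 1 := by
  have hcl : IsClosed {z : ℂ | ‖z - p‖ ^ 3 ≤ 1 - ‖z‖} := isClosed_le (by fun_prop) (by fun_prop)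
  refine hasRelDensity_one_of_volume_diff_le (c := 2 * Real.pi + 2) (r₀ := δ 0) hp
    ((MeasurableSet.iUnion fun n => (hQc n).isClosed.measurableSet).inter hcl.measurableSet)
    ?_ (hδpos 0) fun r hr hr0 => ?_
  · rintro z ⟨hz, -⟩
    obtain ⟨n, hn⟩ := mem_iUnion.1 hz
    exact mem_ball_zero_iff.2 (hQ n z hn)
  have ha1 : Tendsto (fun n => 1 - δ n) atTop (𝓝 1) := by
    simpa using (tendsto_const_nhds (x := (1 : ℝ))).sub hδ0
  have hr1 : r < 1 := hr0.trans (hδ1 0)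
  -- Only rings with `δ (n + 1) < r` meet `B(p, r)`; for these the factor `δ (n + 1) ^ 3` in `hvol`
  -- is at most `r ^ 3`.
  let X : ℕ → Set ℂ := fun n =>
    {z : ℂ | δ (n + 1) < r ∧ (1 - δ n ≤ ‖z‖ ∧ ‖z‖ < 1 - δ (n + 1)) ∧ z ∉ Q n}
  have hX : ∀ n, volume (X n) ≤ ENNReal.ofReal (r ^ 3 * (1 / 2) ^ n) := by
    intro n
    by_cases h : δ (n + 1) < r
    · refine (measure_mono fun z hz => ?_).trans ((hvol n).trans (ENNReal.ofReal_le_ofReal ?_))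
      · exact hz.2
      · exact mul_le_mul_of_nonneg_right (pow_le_pow_left₀ (hδpos _).le h.le 3) (by positivity)
    · have : X n = ∅ := by
        ext z
        simp [X, h]
      rw [this]; simp
  have hsummable : Summable fun n : ℕ => r ^ 3 * (1 / 2 : ℝ) ^ n :=
    summable_geometric_two.mul_left _
  have hXU : volume (⋃ n, X n) ≤ ENNReal.ofReal (2 * r ^ 3) := by
    refine (measure_iUnion_le X).trans ((ENNReal.tsum_le_tsum hX).trans (le_of_eq ?_))
    rw [← ENNReal.ofReal_tsum_of_nonneg (fun n => by positivity) hsummable, tsum_mul_left,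
      tsum_geometric_two, mul_comm]
  have hXr : volume.real (⋃ n, X n) ≤ 2 * r ^ 3 := ENNReal.toReal_le_of_le_ofReal (by positivity) hXU
  have hT := volume_ball_diff_closedBall_le (ρ := r ^ 3) (by positivity)
    (pow_le_one₀ hr.le hr1.le)
  -- A point lost to the cubic cut has `1 - ‖z‖ < ‖z - p‖ ^ 3 < r ^ 3`, so it lies in a thin ring at
  -- the unit circle.
  have hsub : (Metric.ball p r ∩ unitDisc) \ ((⋃ n, Q n) ∩ {z | ‖z - p‖ ^ 3 ≤ 1 - ‖z‖}) ⊆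
      (Metric.ball (0 : ℂ) 1 \ Metric.closedBall 0 (1 - r ^ 3)) ∪ ⋃ n, X n := by
    rintro z ⟨⟨hzp, hz⟩, hzE⟩
    have hz1 : ‖z‖ < 1 := mem_ball_zero_iff.1 hz
    have hzr : ‖z - p‖ < r := mem_ball_iff_norm.1 hzp
    have hclose : 1 - ‖z‖ < r := by
      have := norm_sub_norm_le p z
      rw [hp, norm_sub_rev] at this
      linarith
    by_cases hcub : ‖z - p‖ ^ 3 ≤ 1 - ‖z‖
    · right
      obtain ⟨n, hn1, hn2⟩ := exists_mem_ring ha1 hz1 (by linarith)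
      refine mem_iUnion.2 ⟨n, by linarith, ⟨hn1, hn2⟩, fun hQn => ?_⟩
      exact hzE ⟨mem_iUnion.2 ⟨n, hQn⟩, hcub⟩
    · left
      refine ⟨hz, fun hmem => hcub ?_⟩
      rw [mem_closedBall_zero_iff] at hmem
      have := pow_le_pow_left₀ (norm_nonneg (z - p)) hzr.le 3
      linarith
  have hfin : volume ((Metric.ball (0 : ℂ) 1 \ Metric.closedBall 0 (1 - r ^ 3)) ∪ ⋃ n, X n) ≠ ⊤ :=
    (measure_union_lt_top ((measure_mono sdiff_subset).trans_lt measure_ball_lt_top)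
      (hXU.trans_lt ENNReal.ofReal_lt_top)).ne
  calc _ ≤ _ := measureReal_mono hsub hfin
    _ ≤ _ := measureReal_union_le _ _
    _ ≤ 2 * Real.pi * r ^ 3 + 2 * r ^ 3 := add_le_add hT hXr
    _ = (2 * Real.pi + 2) * r ^ 3 := by ring

/-! ### Construction of the holomorphic function -/

/-- Given any sequence of continuous functions, there is a holomorphic function on the disc that has
the density limit `w` at every boundary point where the sequence converges to `w`. -/
theorem exists_holomorphic_hasDensityLimit (G : ℕ → C(ℂ, ℂ)) :
    ∃ f : ℂ → ℂ, DifferentiableOn ℂ f unitDisc ∧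
      ∀ p w : ℂ, ‖p‖ = 1 → Tendsto (fun n => G n p) atTop (𝓝 w) → HasDensityLimit f p w := by
  have hmod : ∀ n, ∃ η > 0, ∀ z w : ℂ, ‖z‖ ≤ 1 → ‖w‖ ≤ 1 → dist z w < η →
      dist (G n z) (G n w) ≤ 1 / ((n : ℝ) + 1) := by
    intro n
    have huc := (isCompact_closedBall (0 : ℂ) 1).uniformContinuousOn_of_continuous
      (G n).continuous.continuousOn
    obtain ⟨η, hη, h⟩ := Metric.uniformContinuousOn_iff.1 huc (1 / ((n : ℝ) + 1)) (by positivity)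
    exact ⟨η, hη, fun z w hz hw hd =>
      (h z (mem_closedBall_zero_iff.2 hz) w (mem_closedBall_zero_iff.2 hw) hd).le⟩
  choose η hη hG using hmod
  -- `δ n < η n` bounds the width of the `n`-th ring; `δ n < η n ^ 3` turns `‖z - p‖ ^ 3 ≤ 1 - ‖z‖ <
  -- δ n` into `‖z - p‖ < η n`.
  obtain ⟨δ, hδa, hδpos, hδη, hδ1, hδ0⟩ := exists_strictAnti_lt
    (η := fun n => min (η n) (η n ^ 3)) fun n => lt_min (hη n) (pow_pos (hη n) 3)
  choose Q hQc hQr hQv step hstepA hstepQ using fun n => exists_compact_approx_in_ring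
    (G := G n) (a := 1 - δ n) (b := 1 - δ (n + 1)) (by linarith [hδ1 n])
    (by linarith [hδpos (n + 1)])
    (by linarith [hδpos (n + 1), (hδη n).trans_le (min_le_left _ _)] :
      1 - δ (n + 1) - (1 - δ n) < η n) (hG n)
    (v := ENNReal.ofReal (δ (n + 1) ^ 3 * (1 / 2) ^ n))
    (ENNReal.ofReal_pos.2 (mul_pos (pow_pos (hδpos _) 3) (by positivity)))
  have hε : ∀ n : ℕ, (0 : ℝ) < 1 / 2 / 2 ^ n := fun n => by positivity
  let F : ℕ → Polynomial ℂ := fun n => Nat.rec 0 (fun k P => step k P (1 / 2 / 2 ^ k) (hε k)) n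
  have ha1 : Tendsto (fun n => 1 - δ n) atTop (𝓝 1) := by
    simpa using (tendsto_const_nhds (x := (1 : ℝ))).sub hδ0
  have hamono : Monotone fun n => 1 - δ n := fun m n h => by
    have := hδa.antitone h
    change 1 - δ m ≤ 1 - δ n
    linarith
  obtain ⟨f, hf, hfF⟩ := exists_limit_of_geometric_approx hamono ha1 (F := F) fun n z hz => by
    rw [dist_comm]
    exact hstepA n (F n) _ (hε n) z hz
  have hfQ : ∀ n, ∀ z ∈ Q n, dist (f z) (G n z) ≤ 1 / ((n : ℝ) + 1) + 1 / 2 ^ n := by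
    intro n z hz
    have h1 := hfF (n + 1) z (hQr n z hz).2.le
    have h2 := hstepQ n (F n) _ (hε n) z hz
    change dist ((F (n + 1)).eval z) _ ≤ _ at h2
    have h3 := dist_triangle_left (f z) (G n z) ((F (n + 1)).eval z)
    have h4 : (1 : ℝ) / 2 ^ (n + 1) = 1 / 2 / 2 ^ n := by rw [pow_succ]; field_simp
    have h5 : (1 : ℝ) / 2 / 2 ^ n + 1 / 2 / 2 ^ n = 1 / 2 ^ n := by ring
    linarith
  have hQ1 : ∀ n, ∀ z ∈ Q n, ‖z‖ < 1 := fun n z hz => by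
    linarith [(hQr n z hz).2, hδpos (n + 1)]
  refine ⟨f, hf, fun p w hp hw => ⟨(⋃ n, Q n) ∩ {z | ‖z - p‖ ^ 3 ≤ 1 - ‖z‖}, ?_, ?_,
    hasRelDensity_iUnion_inter hδpos hδ1 hδ0 hQc hQ1 hQv hp⟩⟩
  · obtain ⟨C, hC, hCe⟩ := isClosedIn_unitDisc_iUnion hamono ha1 hQc
      fun n z hz => ⟨(hQr n z hz).1, hQ1 n z hz⟩
    refine ⟨C ∩ {z | ‖z - p‖ ^ 3 ≤ 1 - ‖z‖}, hC.inter (isClosed_le (by fun_prop) (by fun_prop)), ?_⟩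
    rw [hCe, inter_right_comm]
  · rw [Metric.tendsto_nhds]
    intro ε hε'
    have hbound : Tendsto (fun n : ℕ => 1 / ((n : ℝ) + 1) + 1 / 2 ^ n + 1 / ((n : ℝ) + 1) +
        dist (G n p) w) atTop (𝓝 0) := by
      have h1 := tendsto_one_div_add_atTop_nhds_zero_nat (𝕜 := ℝ)
      have h2 : Tendsto (fun n : ℕ => 1 / (2 : ℝ) ^ n) atTop (𝓝 0) := by
        simpa [one_div] using tendsto_pow_atTop_nhds_zero_of_lt_one (r := (2⁻¹ : ℝ)) (by norm_num)
          (by norm_num)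
      simpa using ((h1.add h2).add h1).add (tendsto_iff_dist_tendsto_zero.1 hw)
    obtain ⟨m, hm⟩ := eventually_atTop.1 (hbound.eventually (gt_mem_nhds hε'))
    have hnear : ∀ᶠ z in 𝓝 p, 1 - δ m < ‖z‖ :=
      continuous_norm.continuousAt.eventually (lt_mem_nhds (by
        change 1 - δ m < ‖p‖
        rw [hp]
        linarith [hδpos m]))
    filter_upwards [self_mem_nhdsWithin, mem_nhdsWithin_of_mem_nhds hnear] with z hz hzm
    obtain ⟨n, hn⟩ := mem_iUnion.1 hz.1
    -- Points of the set near `p` lie only in rings of large index, where `hm` applies.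
    have hmn : m ≤ n := by
      by_contra hcon
      have h1 := hamono (show n + 1 ≤ m by omega)
      have h2 := (hQr n z hn).2
      have h3 : 1 - δ m < ‖z‖ := hzm
      simp only at h1
      linarith
    have hzp : dist z p < η n := by
      rw [dist_eq_norm]
      have h1 : ‖z - p‖ ^ 3 ≤ 1 - ‖z‖ := hz.2
      have h2 : ‖z - p‖ ^ 3 < η n ^ 3 := by
        linarith [(hQr n z hn).1, (hδη n).trans_le (min_le_right _ _)]
      exact lt_of_pow_lt_pow_left₀ 3 (hη n).le h2
    have h1 := hG n z p (hQ1 n z hn).le hp.le hzp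
    have h2 := hfQ n z hn
    have h3 := dist_triangle4 (f z) (G n z) (G n p) w
    linarith [hm n hmn]

theorem theorem1p1 (ψ : ℝ → ℂ) (S : Set ℝ)
    (hψ : AEMeasurable ψ (volume.restrict (Ico 0 (2 * Real.pi))))
    (hS : IsClosedIn S (Ico 0 (2 * Real.pi)))
    (hψS : ContinuousOn ψ S) :
    ∃ f : ℂ → ℂ, DifferentiableOn ℂ f unitDisc ∧
      (∀ θ ∈ S, HasDensityLimit f (Complex.exp ((θ : ℂ) * Complex.I)) (ψ θ)) ∧
      (∀ᵐ θ : ℝ ∂(volume.restrict (Ico 0 (2 * Real.pi))),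
        HasDensityLimit f (Complex.exp ((θ : ℂ) * Complex.I)) (ψ θ)) := by
  obtain ⟨G, hGS, hGae⟩ := exists_continuousMap_eventually_eq hψ hS hψS
  obtain ⟨f, hf, hlim⟩ := exists_holomorphic_hasDensityLimit G
  refine ⟨f, hf, fun θ hθ => ?_, ?_⟩
  · exact hlim _ _ (Complex.norm_exp_ofReal_mul_I θ) (tendsto_const_nhds.congr'
      ((hGS θ hθ).mono fun n hn => hn.symm))
  · filter_upwards [hGae] with θ hθ
    exact hlim _ _ (Complex.norm_exp_ofReal_mul_I θ) (tendsto_const_nhds.congr'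
      (hθ.mono fun n hn => hn.symm))
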